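/- Let $\mathsf X\subseteq\mathbb R^d$ be open and let $F$ map each point of $\mathsf X$ to a nonempty compact convex subset of $\mathbb R^d$. Assume that $F$ is upper hemicontinuous (for every $x\in\mathsf X$ and every open $O\supseteq F(x)$ there is a neighbourhood $W$ of $x$ with $F(z)\subseteq O$ for all $z\in W\cap\mathsf X$) and locally bounded ($\bigcup_{z\in C}F(z)$ is bounded for every compact $C\subset\mathsf X$). Let $(x_k)_{k\ge0}\subset\mathsf X$ satisfy $$x_k\in x_{k-1}+\gamma_k\{F(y_k)+\eta_k\},\qquad k\ge1,$$ where - $\gamma_k>0$ for all $k \geq 1$, $\sum_{k\ge1}\gamma_k=\infty$ and $\gamma_k\to0$; - $\eta_k=e_k+r_k$ with $\|r_k\|\to0$ and $\sum_{k\ge1}\gamma_ke_k$ convergent; - $y_k\in\mathsf X$ for all $k \geq 1$ and $\|x_k-y_k\|\to0$. Assume there is a compact set $K\subset\mathsf X$ with $x_k\in K$ for all $k\ge1$. For a locally Lipschitz $V:\mathsf X\to\mathbb R$ and $x \in \mathsf X$ let $V^0(x,h)=\limsup_{x'\to x,\,t\downarrow0}\frac{V(x'+th)-V(x')}{t}$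 be its generalized directional derivative in the direction $h$, and let $\bar\partial V(x)=\{w\in\mathbb R^d:\langle h,w\rangle\le V^0(x,h)\ \text{for all } h\in\mathbb R^d\}$ be its Clarke gradient. $V$ is regular if for all $x\in\mathsf X$ and $h\in\mathbb R^d$ the limit $\lim_{t\downarrow0}\frac{V(x+th)-V(x)}{t}$ exists and equals $V^0(x,h)$. The set-valued Lie derivative is $$\mathcal L_FV(x)=\{a\in\mathbb R:\ \exists v\in F(x)\ \text{such that}\ \langle v,w\rangle=a\ \text{for all } w\in\bar\partial V(x)\}.$$ **Theorem.** Let $V:\mathsf X\to\mathbb R$ be locally Lipschitz and regular, and let $U:\mathsf X\to\mathbb R$ be upper semicontinuous with $$\sup\mathcal L_FV(x)\le U(x)\le0\qquad\text{for all }x\in K$$ (with $\sup\emptyset=-\infty$). Set $\mathcal S=\{x\in\mathsf X:U(x)=0\}$. Then: 1. The image under $V$ of the set of limit points of $(x_k)$ is a (nonempty) compact interval $[a,b]$ contained in $V(\mathcal S\cap K)$. 2. If $V(\mathcal S\cap K)$ has empty interior in $\mathbb R$, then $(x_k)$ converges to $\mathcal S\cap K$; that is, $\mathcal S\cap K$ is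 nonempty and $\lim_{k\to\infty}d(x_k,\mathcal S\cap K)=0$. -/

import Mathlib

open Set Filter Topology

noncomputable section

/-- The generalized directional derivative of `f` at `x` in the direction `h`:
`f⁰(x, h) = limsup_{x' → x, t ↓ 0} (f (x' + t h) - f x') / t`.
Meaningful (a genuine limsup of a bounded quotient) when `f` is Lipschitz near `x`. -/
def genDirDeriv {d : ℕ} (f : EuclideanSpace ℝ (Fin d) → ℝ) (x h : EuclideanSpace ℝ (Fin d)) : ℝ :=
  limsup (fun p : EuclideanSpace ℝ (Fin d) × ℝ => (f (p.1 + p.2 • h) - f p.1) / p.2)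
    (𝓝 x ×ˢ 𝓝[>] (0 : ℝ))

/-- The Clarke generalized gradient `∂̄f(x)`. -/
def clarkeGradient {d : ℕ} (f : EuclideanSpace ℝ (Fin d) → ℝ) (x : EuclideanSpace ℝ (Fin d)) :
    Set (EuclideanSpace ℝ (Fin d)) :=
  {w | ∀ h, inner ℝ h w ≤ genDirDeriv f x h}

/-- Clarke regularity at `x`: all one-sided directional derivatives exist and coincide with the
generalized ones. -/
def ClarkeRegularAt {d : ℕ} (f : EuclideanSpace ℝ (Fin d) → ℝ) (x : EuclideanSpace ℝ (Fin d)) :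
    Prop :=
  ∀ h, Tendsto (fun t : ℝ => (f (x + t • h) - f x) / t) (𝓝[>] (0 : ℝ)) (𝓝 (genDirDeriv f x h))

/-- The set-valued Lie derivative `L_F V (x)`. -/
def setLieDerivative {d : ℕ} (F : EuclideanSpace ℝ (Fin d) → Set (EuclideanSpace ℝ (Fin d)))
    (V : EuclideanSpace ℝ (Fin d) → ℝ) (x : EuclideanSpace ℝ (Fin d)) : Set ℝ :=
  {a | ∃ v ∈ F x, ∀ w ∈ clarkeGradient V x, inner ℝ v w = a}

/-- `x` is a perturbed approximate discretization (PAD) of the set-valued map `F` on `X` with step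
sizes `γ`, noise `η` and approximation sequence `y`:
`x k ∈ x (k-1) + γ k • (F (y k) + η k)` for `k ≥ 1`.
The values `γ 0`, `η 0`, `y 0` play no role. -/
def IsPAD {d : ℕ} (X : Set (EuclideanSpace ℝ (Fin d)))
    (F : EuclideanSpace ℝ (Fin d) → Set (EuclideanSpace ℝ (Fin d)))
    (x : ℕ → EuclideanSpace ℝ (Fin d)) (γ : ℕ → ℝ) (η y : ℕ → EuclideanSpace ℝ (Fin d)) : Prop :=
  (∀ k, x k ∈ X) ∧
    ∀ k, ∃ v ∈ F (y (k + 1)), x (k + 1) = x k + γ (k + 1) • (v + η (k + 1))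

/-- `X` is open and `F` is, on `X`, upper hemicontinuous with nonempty values, convex-compact
valued, and locally bounded. Values of `F` outside `X` are irrelevant. -/
structure FieldAssumption {d : ℕ} (X : Set (EuclideanSpace ℝ (Fin d)))
    (F : EuclideanSpace ℝ (Fin d) → Set (EuclideanSpace ℝ (Fin d))) : Prop where
  isOpen : IsOpen X
  nonempty : ∀ z ∈ X, (F z).Nonempty
  upperHemicontinuousOn : UpperHemicontinuousOn F X
  convex : ∀ z ∈ X, Convex ℝ (F z)
  isCompact : ∀ z ∈ X, IsCompact (F z)
  locallyBounded : ∀ C ⊆ X, IsCompact C → Bornology.IsBounded (⋃ z ∈ C, F z)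

/-- Positive step sizes `(γ k)`, `k ≥ 1`, with divergent sum, tending to zero. -/
structure StepSizeAssumption (γ : ℕ → ℝ) : Prop where
  pos : ∀ k, 1 ≤ k → 0 < γ k
  sum_diverges : Tendsto (fun n => ∑ k ∈ Finset.Icc 1 n, γ k) atTop atTop
  tendsto_zero : Tendsto γ atTop (𝓝 0)

/-- The noise splits as `η = e + r` with `r k → 0` and `∑ γ k e k` convergent (as the limit of its
partial sums). -/
def NoiseAssumption {d : ℕ} (γ : ℕ → ℝ) (η : ℕ → EuclideanSpace ℝ (Fin d)) : Prop :=
  ∃ e r : ℕ → EuclideanSpace ℝ (Fin d),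
    (∀ k, 1 ≤ k → η k = e k + r k) ∧
    Tendsto (fun k => ‖r k‖) atTop (𝓝 0) ∧
    ∃ s, Tendsto (fun n => ∑ k ∈ Finset.Icc 1 n, γ k • e k) atTop (𝓝 s)

/-- The approximation sequence `(y k)`, `k ≥ 1`, lies in `X` and satisfies `‖x k - y k‖ → 0`. -/
structure ApproxAssumption {d : ℕ} (X : Set (EuclideanSpace ℝ (Fin d)))
    (x y : ℕ → EuclideanSpace ℝ (Fin d)) : Prop where
  mem : ∀ k, 1 ≤ k → y k ∈ X
  tendsto_zero : Tendsto (fun k => ‖x k - y k‖) atTop (𝓝 0)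

/-- The set of limiting points of a sequence. -/
def limitPoints {d : ℕ} (x : ℕ → EuclideanSpace ℝ (Fin d)) : Set (EuclideanSpace ℝ (Fin d)) :=
  {p | MapClusterPt p atTop x}

/-- `x k` converges to the nonempty set `A`: `d(x k, A) → 0`. -/
def ConvergesToSet {d : ℕ} (x : ℕ → EuclideanSpace ℝ (Fin d))
    (A : Set (EuclideanSpace ℝ (Fin d))) : Prop :=
  A.Nonempty ∧ Tendsto (fun k => Metric.infDist (x k) A) atTop (𝓝 0)

end

/-!
The proof compares the sequence with the curves that it follows in the limit, and uses `V` as a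
Lyapunov function along these curves.

**Limit trajectories.** Measure time by the partial sums of the step sizes. Apart from noise that
is negligible over bounded times (`hasDrift_of_noise`), the sequence moves with bounded velocities
`v k ∈ F (y k)`. Fix base steps `l n → ∞` and an ultrafilter on `ℕ`; for each `t : ℝ`, let `z t` be
the limit along the ultrafilter of the position at elapsed time `t` from the step `l n`. It exists
since `K` is compact, so no equicontinuity argument is needed. The curve `z` is Lipschitz, and its
difference quotients are limits of averages of the `v k`; as `F` is upper hemicontinuous with compact
convex values, `z' t ∈ F (z t)` wherever `z` is differentiable (`exists_trajectory`).

**Decay.** At almost every `t` both `z` and `V ∘ z` are differentiable. By regularity the right and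
left derivatives of `V ∘ z` are the generalized directional derivatives of `V` along `z' t` and
`-z' t`, up to sign; since they agree, `(V ∘ z)' t` lies in the Lie derivative of `V` at `z t`
(`mem_setLieDerivative`), hence is at most `U (z t) ≤ 0`. So `V ∘ z` is antitone, and it is strictly
larger before time `0` than at time `0` if `U (z 0) < 0` (`DecaysAlong.lt_of_neg`).

**Levels.** Let `c` lie strictly between two values of `V` on the limit set. Then `V (x k)` crosses
`c` upwards infinitely often, starting from below some `a < c`. Take the ends of these upcrossings as
base steps: `V (z 0) = c`, and if `U (z 0) < 0`, then `V (z (-s)) > c` for all `s > 0`, so the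
upcrossings take less and less time, although they must cover a positive distance. Hence
`U (z 0) = 0` (`exists_mem_limitPoints_eq_level`). Thus `V` maps the limit set onto a compact interval
whose interior lies in the compact set `V '' (S ∩ K)`, and so does its closure if `a < b`. If the
interval is a point, `V` is constant along limit trajectories, which forces `U = 0` on the limit set
(`eq_zero_of_subsingleton`); this covers the case `a = b` and the convergence to `S ∩ K`.
-/

/-! ### The time scale of the step sizes -/

/-- The time elapsed after `n` steps: `γ 1 + ⋯ + γ n`. -/
def elapsed (γ : ℕ → ℝ) (n : ℕ) : ℝ := ∑ k ∈ Finset.Icc 1 n, γ k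

/-- The first step whose elapsed time is at least `t`. When the step sizes have a divergent sum
the set below is nonempty and the infimum is attained. -/
noncomputable def timeIndex (γ : ℕ → ℝ) (t : ℝ) : ℕ := sInf {n | t ≤ elapsed γ n}

theorem elapsed_succ (γ : ℕ → ℝ) (n : ℕ) : elapsed γ (n + 1) = elapsed γ n + γ (n + 1) := by
  rw [elapsed, elapsed, Finset.sum_Icc_succ_top (by omega)]

theorem sum_Icc_one_sub {E : Type*} [AddCommGroup E] (f : ℕ → E) {p q : ℕ} (h : p ≤ q) :
    ∑ k ∈ Finset.Icc 1 q, f k - ∑ k ∈ Finset.Icc 1 p, f k = ∑ k ∈ Finset.Ioc p q, f k := by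
  have hI : ∀ n, Finset.Icc 1 n = Finset.Ioc 0 n := fun n => by ext; simp [Nat.succ_le_iff]
  rw [hI, hI, ← Finset.sum_Ioc_consecutive f (Nat.zero_le p) h, add_sub_cancel_left]

theorem elapsed_sub (γ : ℕ → ℝ) {p q : ℕ} (h : p ≤ q) :
    elapsed γ q - elapsed γ p = ∑ k ∈ Finset.Ioc p q, γ k :=
  sum_Icc_one_sub γ h

namespace StepSizeAssumption

variable {γ : ℕ → ℝ}

theorem strictMono_elapsed (hγ : StepSizeAssumption γ) : StrictMono (elapsed γ) :=
  strictMono_nat_of_lt_succ fun n => by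
    rw [elapsed_succ]; linarith [hγ.pos (n + 1) (by omega)]

theorem tendsto_elapsed (hγ : StepSizeAssumption γ) : Tendsto (elapsed γ) atTop atTop :=
  hγ.sum_diverges

theorem le_elapsed_timeIndex (hγ : StepSizeAssumption γ) (t : ℝ) :
    t ≤ elapsed γ (timeIndex γ t) :=
  Nat.sInf_mem (s := {n | t ≤ elapsed γ n})
    (hγ.tendsto_elapsed.eventually_ge_atTop t).exists

theorem timeIndex_le (hγ : StepSizeAssumption γ) {t : ℝ} {n : ℕ} :
    timeIndex γ t ≤ n ↔ t ≤ elapsed γ n :=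
  ⟨fun h => (hγ.le_elapsed_timeIndex t).trans (hγ.strictMono_elapsed.monotone h),
    fun h => Nat.sInf_le h⟩

theorem timeIndex_mono (hγ : StepSizeAssumption γ) : Monotone (timeIndex γ) := fun _ _ h =>
  hγ.timeIndex_le.2 (h.trans (hγ.le_elapsed_timeIndex _))

theorem timeIndex_elapsed (hγ : StepSizeAssumption γ) (n : ℕ) :
    timeIndex γ (elapsed γ n) = n :=
  le_antisymm (hγ.timeIndex_le.2 le_rfl)
    (hγ.strictMono_elapsed.le_iff_le.1 (hγ.le_elapsed_timeIndex _))

theorem tendsto_timeIndex (hγ : StepSizeAssumption γ) : Tendsto (timeIndex γ) atTop atTop := by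
  refine tendsto_atTop_atTop_of_monotone hγ.timeIndex_mono fun n => ⟨elapsed γ n, ?_⟩
  rw [hγ.timeIndex_elapsed]

/-- The overshoot of `timeIndex` vanishes at infinity, because it is less than one step size. -/
theorem tendsto_elapsed_timeIndex_sub (hγ : StepSizeAssumption γ) :
    Tendsto (fun t => elapsed γ (timeIndex γ t) - t) atTop (𝓝 0) := by
  refine tendsto_of_tendsto_of_tendsto_of_le_of_le' tendsto_const_nhds
    (hγ.tendsto_zero.comp hγ.tendsto_timeIndex)
    (Eventually.of_forall fun t => sub_nonneg.2 (hγ.le_elapsed_timeIndex t)) ?_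
  filter_upwards [hγ.tendsto_timeIndex.eventually_ge_atTop 1] with t ht
  obtain ⟨n, hn⟩ := Nat.exists_eq_add_of_le' ht
  have h : elapsed γ n < t := by
    by_contra! h
    have := hγ.timeIndex_le.2 h
    omega
  simp only [Function.comp_apply, hn, elapsed_succ]
  linarith

/-- Along any filter for which the base step `l` tends to infinity, the step reached at time `t`
after step `l` is elapsed time `t` away from `l`, up to a vanishing error. -/
theorem tendsto_elapsed_shift (hγ : StepSizeAssumption γ) {f : Filter ℕ} {l : ℕ → ℕ}
    (hl : Tendsto l f atTop) (t : ℝ) :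
    Tendsto (fun n => elapsed γ (timeIndex γ (elapsed γ (l n) + t)) - elapsed γ (l n)) f
      (𝓝 t) := by
  have h : Tendsto (fun n => elapsed γ (l n) + t) f atTop :=
    tendsto_atTop_add_const_right _ _ (hγ.tendsto_elapsed.comp hl)
  simpa using ((hγ.tendsto_elapsed_timeIndex_sub.comp h).add_const t).congr
    fun n => by simp only [Function.comp_apply]; ring

theorem tendsto_timeIndex_shift (hγ : StepSizeAssumption γ) {f : Filter ℕ} {l : ℕ → ℕ}
    (hl : Tendsto l f atTop) (t : ℝ) :
    Tendsto (fun n => timeIndex γ (elapsed γ (l n) + t)) f atTop :=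
  hγ.tendsto_timeIndex.comp
    (tendsto_atTop_add_const_right _ _ (hγ.tendsto_elapsed.comp hl))

end StepSizeAssumption

/-! ### Sequences that follow a bounded drift -/

/-- The sequence `x` is driven by the drifts `v`, which are eventually bounded by `M`: over long
stretches of steps, the increments of `x` are the integrated drifts, up to an error that is
eventually small compared with `1` plus the elapsed time. -/
structure HasDrift {E : Type*} [NormedAddCommGroup E] [NormedSpace ℝ E] (γ : ℕ → ℝ)
    (x v : ℕ → E) (M : ℝ) : Prop where
  bound : ∀ᶠ k in atTop, ‖v k‖ ≤ M
  error : ∀ ε > 0, ∃ N, ∀ p q, N ≤ p → p ≤ q →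
    ‖x q - x p - ∑ k ∈ Finset.Ioc p q, γ k • v k‖ ≤ ε * (1 + (elapsed γ q - elapsed γ p))

theorem norm_sum_smul_le {E : Type*} [NormedAddCommGroup E] [NormedSpace ℝ E] {γ : ℕ → ℝ}
    (hγ : StepSizeAssumption γ) {v : ℕ → E} {M : ℝ} {p q : ℕ} (hpq : p ≤ q)
    (h : ∀ k, p < k → ‖v k‖ ≤ M) :
    ‖∑ k ∈ Finset.Ioc p q, γ k • v k‖ ≤ M * (elapsed γ q - elapsed γ p) := by
  rw [elapsed_sub γ hpq, Finset.mul_sum]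
  refine (norm_sum_le _ _).trans (Finset.sum_le_sum fun k hk => ?_)
  have hk' := (Finset.mem_Ioc.1 hk).1
  have hp := hγ.pos k (by omega)
  rw [norm_smul, Real.norm_of_nonneg hp.le, mul_comm M]
  exact mul_le_mul_of_nonneg_left (h k hk') hp.le

/-- The noise does not contribute to the drift: the part `e` because the series `∑ γ k e k`
converges, the part `r` because it tends to zero. -/
theorem hasDrift_of_noise {d : ℕ} {γ : ℕ → ℝ} {x v η : ℕ → EuclideanSpace ℝ (Fin d)} {M : ℝ}
    (hγ : StepSizeAssumption γ) (hη : NoiseAssumption γ η)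
    (hx : ∀ k, x (k + 1) = x k + γ (k + 1) • (v (k + 1) + η (k + 1)))
    (hv : ∀ᶠ k in atTop, ‖v k‖ ≤ M) : HasDrift γ x v M := by
  obtain ⟨e, r, her, hr, s, hs⟩ := hη
  refine ⟨hv, fun ε hε => ?_⟩
  obtain ⟨N₁, hN₁⟩ := Metric.cauchySeq_iff.1 hs.cauchySeq ε hε
  obtain ⟨N₂, hN₂⟩ := eventually_atTop.1 (hr.eventually (gt_mem_nhds hε))
  refine ⟨max N₁ N₂, fun p q hp hpq => ?_⟩
  have hsum : x q - x p = ∑ k ∈ Finset.Ioc p q, γ k • (v k + η k) := by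
    induction q, hpq using Nat.le_induction with
    | base => simp
    | succ q hpq ih =>
      rw [Finset.sum_Ioc_succ_top hpq, ← ih, hx]
      abel
  have hsplit : x q - x p - ∑ k ∈ Finset.Ioc p q, γ k • v k
      = ∑ k ∈ Finset.Ioc p q, γ k • e k + ∑ k ∈ Finset.Ioc p q, γ k • r k := by
    rw [hsum, ← Finset.sum_sub_distrib, ← Finset.sum_add_distrib]
    refine Finset.sum_congr rfl fun k hk => ?_
    rw [her k (by have := (Finset.mem_Ioc.1 hk).1; omega)]
    module
  have he : ‖∑ k ∈ Finset.Ioc p q, γ k • e k‖ ≤ ε := by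
    rw [← sum_Icc_one_sub _ hpq, ← dist_eq_norm]
    exact (hN₁ q (by omega) p (by omega)).le
  have hr' := norm_sum_smul_le hγ (v := r) (M := ε) hpq
    fun k hk => (hN₂ k (by omega)).le
  rw [hsplit]
  linarith [norm_add_le (∑ k ∈ Finset.Ioc p q, γ k • e k) (∑ k ∈ Finset.Ioc p q, γ k • r k)]

namespace HasDrift

variable {E : Type*} [NormedAddCommGroup E] [NormedSpace ℝ E] {γ : ℕ → ℝ} {x v : ℕ → E} {M : ℝ}

theorem norm_sub_le (h : HasDrift γ x v M) (hγ : StepSizeAssumption γ) {ε : ℝ} (hε : 0 < ε) :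
    ∃ N, ∀ p q, N ≤ p → p ≤ q → ‖x q - x p‖ ≤
      M * (elapsed γ q - elapsed γ p) + ε * (1 + (elapsed γ q - elapsed γ p)) := by
  obtain ⟨N₁, hN₁⟩ := eventually_atTop.1 h.bound
  obtain ⟨N₂, hN₂⟩ := h.error ε hε
  refine ⟨max N₁ N₂, fun p q hp hpq => ?_⟩
  have h₁ := hN₂ p q (by omega) hpq
  have h₂ := norm_sum_smul_le hγ (v := v) (M := M) hpq fun k hk => hN₁ k (by omega)
  linarith [norm_le_norm_sub_add (x q - x p) (∑ k ∈ Finset.Ioc p q, γ k • v k)]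

/-- In the limit, two positions are at distance at most `M` times an asymptotic upper bound for the
elapsed time between them. -/
theorem norm_sub_le_of_tendsto (h : HasDrift γ x v M) (hM : 0 ≤ M) (hγ : StepSizeAssumption γ)
    {f : Filter ℕ} [f.NeBot] {p q : ℕ → ℕ} {a b : E} {s : ℝ} {T : ℕ → ℝ}
    (hp : Tendsto p f atTop) (hpq : ∀ᶠ n in f, p n ≤ q n)
    (hT : ∀ᶠ n in f, elapsed γ (q n) - elapsed γ (p n) ≤ T n) (hs : Tendsto T f (𝓝 s))
    (ha : Tendsto (fun n => x (p n)) f (𝓝 a)) (hb : Tendsto (fun n => x (q n)) f (𝓝 b)) :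
    ‖b - a‖ ≤ M * s := by
  have key : ∀ ε > 0, ‖b - a‖ ≤ M * s + ε * (1 + s) := fun ε hε => by
    obtain ⟨N, hN⟩ := h.norm_sub_le hγ hε
    refine le_of_tendsto_of_tendsto (hb.sub ha).norm
      ((hs.const_mul M).add ((hs.const_add 1).const_mul ε)) ?_
    filter_upwards [hp.eventually_ge_atTop N, hpq, hT] with n h₁ h₂ h₃
    refine (hN _ _ h₁ h₂).trans ?_
    gcongr
  have hlim : Tendsto (fun ε : ℝ => M * s + ε * (1 + s)) (𝓝[>] 0) (𝓝 (M * s)) := by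
    have : Continuous fun ε : ℝ => M * s + ε * (1 + s) := by fun_prop
    simpa using (this.tendsto 0).mono_left nhdsWithin_le_nhds
  exact ge_of_tendsto hlim (eventually_mem_nhdsWithin.mono fun ε hε => key ε hε)

/-- Consecutive positions are asymptotically equal. -/
theorem tendsto_succ_sub (h : HasDrift γ x v M) (hγ : StepSizeAssumption γ)
    {f : Filter ℕ} {p : ℕ → ℕ} (hp : Tendsto p f atTop) :
    Tendsto (fun n => x (p n + 1) - x (p n)) f (𝓝 0) := by
  have hd : Tendsto (fun k => x (k + 1) - x k) atTop (𝓝 0) := by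
    rw [tendsto_zero_iff_norm_tendsto_zero, Metric.tendsto_atTop]
    intro ε hε
    have hγ' : Tendsto (fun k => γ (k + 1)) atTop (𝓝 0) :=
      hγ.tendsto_zero.comp (tendsto_add_atTop_nat 1)
    obtain ⟨N, hN⟩ := h.norm_sub_le hγ (half_pos hε)
    have hlim : Tendsto (fun k => M * γ (k + 1) + ε / 2 * (1 + γ (k + 1))) atTop
        (𝓝 (M * 0 + ε / 2 * (1 + 0))) :=
      (hγ'.const_mul M).add ((hγ'.const_add 1).const_mul _)
    obtain ⟨N', hN'⟩ := eventually_atTop.1 (hlim.eventually_lt_const (u := ε) (by linarith))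
    refine ⟨max N N', fun k hk => ?_⟩
    have h₁ := hN k (k + 1) (by omega) (by omega)
    rw [elapsed_succ, add_sub_cancel_left] at h₁
    rw [Real.dist_eq, sub_zero, abs_norm]
    exact h₁.trans_lt (hN' k (by omega))
  exact hd.comp hp

end HasDrift

/-! ### Limit trajectories -/

theorem exists_tendsto_of_isCompact {E : Type*} [TopologicalSpace E] {x : ℕ → E}
    {K : Set E} (hK : IsCompact K) (hxK : ∀ k, 1 ≤ k → x k ∈ K)
    (f : Ultrafilter ℕ) {p : ℕ → ℕ} (hp : Tendsto p f atTop) :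
    ∃ a ∈ K, Tendsto (fun n => x (p n)) f (𝓝 a) :=
  hK.ultrafilter_le_nhds (f.map fun n => x (p n)) <| by
    rw [Ultrafilter.coe_map, le_principal_iff, mem_map]
    exact (hp.eventually_ge_atTop 1).mono fun _ hn => hxK _ hn

/-- Near each compact part of `X`, and hence along `y`, the values of `F` are bounded. -/
theorem FieldAssumption.exists_bound {d : ℕ} {X K : Set (EuclideanSpace ℝ (Fin d))}
    {F : EuclideanSpace ℝ (Fin d) → Set (EuclideanSpace ℝ (Fin d))}
    {x y v : ℕ → EuclideanSpace ℝ (Fin d)}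
    (hF : FieldAssumption X F) (hK : IsCompact K) (hKX : K ⊆ X) (hxK : ∀ k, 1 ≤ k → x k ∈ K)
    (hy : ApproxAssumption X x y) (hv : ∀ k, 1 ≤ k → v k ∈ F (y k)) :
    ∃ M, 0 ≤ M ∧ ∀ᶠ k in atTop, ‖v k‖ ≤ M := by
  obtain ⟨δ, hδ, hδX⟩ := hK.exists_cthickening_subset_open hF.isOpen hKX
  obtain ⟨M, hM⟩ := (hF.locallyBounded _ hδX hK.cthickening).exists_norm_le
  refine ⟨max M 0, le_max_right _ _, ?_⟩
  filter_upwards [hy.tendsto_zero.eventually_lt_const hδ, eventually_ge_atTop 1] with k hk hk1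
  refine (hM (v k) (mem_biUnion ?_ (hv k hk1))).trans (le_max_left _ _)
  refine Metric.mem_cthickening_of_dist_le (y k) (x k) δ K (hxK k hk1) ?_
  rw [dist_comm, dist_eq_norm]
  exact hk.le

/-- If the drifts eventually lie in a closed convex set along the steps from `p` to `q`, then so
does the limit of the mean velocities. -/
theorem HasDrift.mem_of_convex {E : Type*} [NormedAddCommGroup E] [NormedSpace ℝ E] {γ : ℕ → ℝ}
    {x v : ℕ → E} {M : ℝ} (h : HasDrift γ x v M) (hγ : StepSizeAssumption γ) {A : Set E}
    (hA : Convex ℝ A) (hAc : IsClosed A) {f : Filter ℕ} [f.NeBot] {p q : ℕ → ℕ} {a b : E} {s : ℝ}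
    (hs : 0 < s) (hp : Tendsto p f atTop)
    (hT : Tendsto (fun n => elapsed γ (q n) - elapsed γ (p n)) f (𝓝 s))
    (ha : Tendsto (fun n => x (p n)) f (𝓝 a)) (hb : Tendsto (fun n => x (q n)) f (𝓝 b))
    (hv : ∀ᶠ n in f, ∀ k ∈ Finset.Ioc (p n) (q n), v k ∈ A) :
    s⁻¹ • (b - a) ∈ A := by
  set T : ℕ → ℝ := fun n => elapsed γ (q n) - elapsed γ (p n)
  have hpos : ∀ᶠ n in f, 0 < T n := hT.eventually_const_lt hs
  have hpq : ∀ᶠ n in f, p n ≤ q n := hpos.mono fun n hn =>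
    (hγ.strictMono_elapsed.lt_iff_lt.1 (sub_pos.1 hn)).le
  have herr : Tendsto (fun n => x (q n) - x (p n) - ∑ k ∈ Finset.Ioc (p n) (q n), γ k • v k) f
      (𝓝 0) := by
    rw [Metric.tendsto_nhds]
    intro ε hε
    have hs1 : 0 < 2 + s := by linarith
    obtain ⟨N, hN⟩ := h.error (ε / (2 + s)) (by positivity)
    filter_upwards [hp.eventually_ge_atTop N, hpq,
      hT.eventually_lt_const (lt_add_one s)] with n h₁ h₂ h₃
    rw [dist_zero_right]
    refine (hN _ _ h₁ h₂).trans_lt ?_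
    rw [div_mul_eq_mul_div, div_lt_iff₀ hs1]
    exact mul_lt_mul_of_pos_left (by change 1 + T n < _; linarith [show T n < s + 1 from h₃]) hε
  have hlim : Tendsto (fun n => (T n)⁻¹ • ∑ k ∈ Finset.Ioc (p n) (q n), γ k • v k) f
      (𝓝 (s⁻¹ • (b - a))) := by
    have h₁ := (hT.inv₀ hs.ne').smul ((hb.sub ha).sub herr)
    simpa using h₁
  refine hAc.mem_of_tendsto hlim ?_
  filter_upwards [hv, hpos, hpq] with n h₁ h₂ h₃
  have hsum : T n = ∑ k ∈ Finset.Ioc (p n) (q n), γ k := elapsed_sub γ h₃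
  have := hA.centerMass_mem (t := Finset.Ioc (p n) (q n)) (w := γ) (z := v)
    (fun k hk => (hγ.pos k (by have := (Finset.mem_Ioc.1 hk).1; omega)).le) (hsum ▸ h₂) h₁
  rwa [Finset.centerMass, ← hsum] at this

/-- Positions of the sequence, seen from the steps `l n` at elapsed time `t`, converge along an
ultrafilter to a Lipschitz curve in `K` that solves the differential inclusion `z' ∈ F z` wherever
it is differentiable. Pointwise convergence along the ultrafilter comes from compactness of `K`. -/
theorem exists_trajectory {d : ℕ} {X K : Set (EuclideanSpace ℝ (Fin d))}
    {F : EuclideanSpace ℝ (Fin d) → Set (EuclideanSpace ℝ (Fin d))} {γ : ℕ → ℝ}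
    {x y v : ℕ → EuclideanSpace ℝ (Fin d)} {M : ℝ} (hM : 0 ≤ M)
    (hF : FieldAssumption X F) (hγ : StepSizeAssumption γ) (hy : ApproxAssumption X x y)
    (hK : IsCompact K) (hKX : K ⊆ X) (hxK : ∀ k, 1 ≤ k → x k ∈ K)
    (hv : ∀ k, 1 ≤ k → v k ∈ F (y k)) (h : HasDrift γ x v M)
    (f : Ultrafilter ℕ) {l : ℕ → ℕ} (hl : Tendsto l f atTop) :
    ∃ z : ℝ → EuclideanSpace ℝ (Fin d),
      (∃ C, LipschitzWith C z) ∧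
      (∀ t, Tendsto (fun n => x (timeIndex γ (elapsed γ (l n) + t))) f (𝓝 (z t))) ∧
      (∀ t, z t ∈ K) ∧ ∀ t w, HasDerivAt z w t → w ∈ F (z t) := by
  set m : ℝ → ℕ → ℕ := fun t n => timeIndex γ (elapsed γ (l n) + t)
  have hm : ∀ t, Tendsto (m t) f atTop := fun t => hγ.tendsto_timeIndex_shift hl t
  have hmono : ∀ {s t}, s ≤ t → ∀ n, m s n ≤ m t n := fun hst n =>
    hγ.timeIndex_mono (by linarith)
  have hdiff : ∀ s t, Tendsto (fun n => elapsed γ (m t n) - elapsed γ (m s n)) f (𝓝 (t - s)) :=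
    fun s t => ((hγ.tendsto_elapsed_shift hl t).sub (hγ.tendsto_elapsed_shift hl s)).congr
      fun n => by simp only [m]; ring
  have hex : ∀ t, ∃ p ∈ K, Tendsto (fun n => x (m t n)) f (𝓝 p) := fun t =>
    exists_tendsto_of_isCompact hK hxK f (hm t)
  choose z hzK hz using hex
  have hnorm : ∀ {s t}, s ≤ t → ‖z t - z s‖ ≤ M * (t - s) := fun {s t} hst =>
    h.norm_sub_le_of_tendsto hM hγ (hm s) (Eventually.of_forall (hmono hst))
      (Eventually.of_forall fun _ => le_rfl) (hdiff s t) (hz s) (hz t)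
  refine ⟨z, ⟨⟨M, hM⟩, LipschitzWith.of_dist_le_mul fun s t => ?_⟩, hz, hzK, fun t w hw => ?_⟩
  · rw [dist_eq_norm, Real.dist_eq]
    rcases le_total s t with hst | hst
    · rw [norm_sub_rev, abs_sub_comm, abs_of_nonneg (sub_nonneg.2 hst)]
      exact hnorm hst
    · rw [abs_of_nonneg (sub_nonneg.2 hst)]
      exact hnorm hst
  have hztX := hKX (hzK t)
  rw [← (hF.isCompact _ hztX).isClosed.closure_eq, Metric.closure_eq_iInter_cthickening]
  refine mem_iInter₂.2 fun ε hε => ?_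
  set A := Metric.cthickening ε (F (z t))
  -- Close to `z t` the field takes values in the closed convex set `A`; for a short time, the
  -- points `y k` stay in this neighbourhood.
  have hnhds : ∀ᶠ u in 𝓝 (z t), F u ⊆ A := by
    have := hF.upperHemicontinuousOn.forall_isOpen _ hztX _ Metric.isOpen_thickening
      (Metric.self_subset_thickening hε (F (z t)))
    rw [hF.isOpen.nhdsWithin_eq hztX] at this
    exact this.mono fun u hu => hu.trans (Metric.thickening_subset_cthickening _ _)
  obtain ⟨δ, hδ, hδA⟩ := Metric.eventually_nhds_iff.1 hnhds
  have hshort : ∀ᶠ r in 𝓝[>] (0 : ℝ), M * r + δ / 4 * (1 + r) < δ / 2 := by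
    have hc : Continuous fun r : ℝ => M * r + δ / 4 * (1 + r) := by fun_prop
    exact ((hc.tendsto 0).mono_left nhdsWithin_le_nhds).eventually_lt_const (by linarith)
  have hslope : Tendsto (fun r : ℝ => r⁻¹ • (z (t + r) - z t)) (𝓝[>] 0) (𝓝 w) :=
    (hasDerivAt_iff_tendsto_slope_zero.1 hw).mono_left
      (nhdsWithin_mono _ fun r hr => (mem_Ioi.1 hr).ne')
  refine Metric.isClosed_cthickening.mem_of_tendsto hslope ?_
  filter_upwards [hshort, self_mem_nhdsWithin] with r hr hr0
  rw [mem_Ioi] at hr0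
  have hT : Tendsto (fun n => elapsed γ (m (t + r) n) - elapsed γ (m t n)) f (𝓝 r) := by
    simpa using hdiff t (t + r)
  refine h.mem_of_convex hγ ((hF.convex _ hztX).cthickening ε) Metric.isClosed_cthickening hr0
    (hm t) hT (hz t) (hz (t + r)) ?_
  obtain ⟨N, hN⟩ := h.norm_sub_le hγ (ε := δ / 4) (by linarith)
  obtain ⟨N', hN'⟩ := eventually_atTop.1 (hy.tendsto_zero.eventually_lt_const
    (show 0 < δ / 4 by linarith))
  have hTs := ((hT.const_mul M).add ((hT.const_add 1).const_mul (δ / 4))).eventually_lt_const hr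
  filter_upwards [(hm t).eventually_ge_atTop (max N N'), hTs,
    (hz t).eventually (Metric.ball_mem_nhds _ (show 0 < δ / 4 by linarith))] with n h₁ h₂ h₃ k hk
  obtain ⟨hk₁, hk₂⟩ := Finset.mem_Ioc.1 hk
  refine hδA (y := y k) ?_ (hv k (by omega))
  have hxk := hN (m t n) k (by omega) hk₁.le
  have hle : elapsed γ k - elapsed γ (m t n) ≤ elapsed γ (m (t + r) n) - elapsed γ (m t n) :=
    sub_le_sub_right (hγ.strictMono_elapsed.monotone hk₂) _
  have hyk := hN' k (by omega)
  rw [← dist_eq_norm] at hxk hyk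
  have h₃' : dist (x (m t n)) (z t) < δ / 4 := h₃
  have h₄ : dist (x k) (x (m t n)) < δ / 2 := by
    refine (hxk.trans ?_).trans_lt h₂
    gcongr
  linarith [dist_triangle (y k) (x k) (z t), dist_triangle (x k) (x (m t n)) (z t),
    dist_comm (x k) (y k)]

/-! ### Decay of a regular function along a trajectory -/

theorem LipschitzWith.sub_le_of_ae_deriv_le {f : ℝ → ℝ} {C : NNReal} (hf : LipschitzWith C f)
    {a b c : ℝ} (hab : a ≤ b) (h : ∀ᵐ t, t ∈ Icc a b → deriv f t ≤ c) :
    f b - f a ≤ c * (b - a) := by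
  have hac : AbsolutelyContinuousOnInterval f a b :=
    (hf.lipschitzOnWith (s := uIcc a b)).absolutelyContinuousOnInterval
  rw [← hac.integral_deriv_eq_sub]
  refine (intervalIntegral.integral_mono_ae_restrict hab hac.intervalIntegrable_deriv
    (intervalIntegrable_const (c := c)) ?_).trans_eq ?_
  · exact (MeasureTheory.ae_restrict_iff' measurableSet_Icc).2 h
  · rw [intervalIntegral.integral_const, smul_eq_mul, mul_comm]

section

variable {d : ℕ}

/-- Chain rule: for a locally Lipschitz function that is regular at `z t`, the right derivative of
`V ∘ z` is the one-sided directional derivative of `V` along the velocity. -/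
theorem ClarkeRegularAt.genDirDeriv_eq {V : EuclideanSpace ℝ (Fin d) → ℝ}
    {X : Set (EuclideanSpace ℝ (Fin d))} (hX : IsOpen X) (hV : LocallyLipschitzOn X V)
    {z : ℝ → EuclideanSpace ℝ (Fin d)} {t : ℝ} (hzX : z t ∈ X) (hreg : ClarkeRegularAt V (z t))
    {w : EuclideanSpace ℝ (Fin d)} {g : ℝ} (hz : HasDerivAt z w t)
    (hg : HasDerivAt (fun s => V (z s)) g t) : genDirDeriv V (z t) w = g := by
  obtain ⟨C, N, hN, hC⟩ := hV hzX
  rw [hX.nhdsWithin_eq hzX] at hN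
  have hle : 𝓝[>] (0 : ℝ) ≤ 𝓝[≠] 0 := nhdsWithin_mono _ fun r hr => (mem_Ioi.1 hr).ne'
  have hle' : 𝓝[>] (0 : ℝ) ≤ 𝓝 0 := nhdsWithin_le_nhds
  have h₁ := (hasDerivAt_iff_tendsto_slope_zero.1 hg).mono_left hle
  have h₂ := (hasDerivAt_iff_tendsto_slope_zero.1 hz).mono_left hle
  have hcurve : ∀ᶠ r in 𝓝[>] (0 : ℝ), z (t + r) ∈ N := by
    have : Tendsto (fun r => z (t + r)) (𝓝 0) (𝓝 (z t)) :=
      hz.continuousAt.tendsto.comp (by simpa using (continuous_const_add t).tendsto 0)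
    exact (this.mono_left hle').eventually hN
  have hline : ∀ᶠ r in 𝓝[>] (0 : ℝ), z t + r • w ∈ N := by
    have hc : Continuous fun r : ℝ => z t + r • w := by fun_prop
    have : Tendsto (fun r : ℝ => z t + r • w) (𝓝 0) (𝓝 (z t)) := by simpa using hc.tendsto 0
    exact (this.mono_left hle').eventually hN
  -- The curve and its tangent line give the same difference quotients of `V` in the limit.
  have hsub : Tendsto (fun r : ℝ => (V (z t + r • w) - V (z t)) / r
      - r⁻¹ • (V (z (t + r)) - V (z t))) (𝓝[>] 0) (𝓝 0) := by
    have h₃ : Tendsto (fun r : ℝ => C * ‖r⁻¹ • (z (t + r) - z t) - w‖) (𝓝[>] 0) (𝓝 0) := by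
      simpa using (tendsto_iff_norm_sub_tendsto_zero.1 h₂).const_mul (C : ℝ)
    refine squeeze_zero_norm' ?_ h₃
    filter_upwards [hcurve, hline, self_mem_nhdsWithin] with r hr₁ hr₂ hr
    rw [mem_Ioi] at hr
    have h₄ := hC.dist_le_mul _ hr₂ _ hr₁
    rw [Real.dist_eq, dist_eq_norm] at h₄
    have h₅ : (V (z t + r • w) - V (z t)) / r - r⁻¹ • (V (z (t + r)) - V (z t))
        = r⁻¹ * (V (z t + r • w) - V (z (t + r))) := by
      rw [smul_eq_mul]; field_simp; ring
    have h₆ : r⁻¹ • (z (t + r) - z t) - w = -(r⁻¹ • (z t + r • w - z (t + r))) := by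
      have : w = r⁻¹ • r • w := by rw [smul_smul, inv_mul_cancel₀ hr.ne', one_smul]
      nth_rewrite 1 [this]
      module
    rw [h₅, h₆, norm_neg, norm_smul, norm_mul, Real.norm_eq_abs (V _ - _), mul_left_comm]
    gcongr
  have h₄ := h₁.add hsub
  simp only [add_sub_cancel, add_zero] at h₄
  exact tendsto_nhds_unique (hreg w) h₄

/-- Wherever both `z` and `V ∘ z` are differentiable, comparing the right and left derivatives
of `V ∘ z` shows that all Clarke gradients have the same inner product with the velocity: the
derivative of `V ∘ z` belongs to the Lie derivative. -/
theorem mem_setLieDerivative {F : EuclideanSpace ℝ (Fin d) → Set (EuclideanSpace ℝ (Fin d))}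
    {V : EuclideanSpace ℝ (Fin d) → ℝ} {X : Set (EuclideanSpace ℝ (Fin d))} (hX : IsOpen X)
    (hV : LocallyLipschitzOn X V) {z : ℝ → EuclideanSpace ℝ (Fin d)} {t : ℝ} (hzX : z t ∈ X)
    (hreg : ClarkeRegularAt V (z t)) {w : EuclideanSpace ℝ (Fin d)} {g : ℝ}
    (hz : HasDerivAt z w t) (hg : HasDerivAt (fun s => V (z s)) g t) (hw : w ∈ F (z t)) :
    g ∈ setLieDerivative F V (z t) := by
  refine ⟨w, hw, fun u hu => le_antisymm ?_ ?_⟩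
  · rw [← hreg.genDirDeriv_eq hX hV hzX hz hg]
    exact hu w
  · have ht : t = 2 * t - t := by ring
    have hz' : HasDerivAt (fun s => z (2 * t - s)) (-w) t :=
      HasDerivAt.comp_const_sub _ _ (ht ▸ hz)
    have hg' : HasDerivAt (fun s => V (z (2 * t - s))) (-g) t :=
      HasDerivAt.comp_const_sub (f := fun s => V (z s)) _ _ (ht ▸ hg)
    have h := ClarkeRegularAt.genDirDeriv_eq (z := fun s => z (2 * t - s)) (t := t) hX hV
      (by simpa only [← ht] using hzX) (by simpa only [← ht] using hreg) hz' hg'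
    simp only [← ht] at h
    have := hu (-w)
    rw [h, inner_neg_left] at this
    linarith

/-- A curve `z` in `K` along which `V` decays at rate `U`: the function `V ∘ z` is Lipschitz, and
its derivative is almost everywhere at most `U ∘ z`. -/
structure DecaysAlong (V U : EuclideanSpace ℝ (Fin d) → ℝ) (K : Set (EuclideanSpace ℝ (Fin d)))
    (z : ℝ → EuclideanSpace ℝ (Fin d)) : Prop where
  mem : ∀ t, z t ∈ K
  continuous : Continuous z
  lipschitz : ∃ C, LipschitzWith C fun t => V (z t)
  deriv_le : ∀ᵐ t, deriv (fun t => V (z t)) t ≤ U (z t)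

theorem decaysAlong_of_solution {X K : Set (EuclideanSpace ℝ (Fin d))}
    {F : EuclideanSpace ℝ (Fin d) → Set (EuclideanSpace ℝ (Fin d))}
    {V U : EuclideanSpace ℝ (Fin d) → ℝ} (hX : IsOpen X) (hK : IsCompact K) (hKX : K ⊆ X)
    (hV : LocallyLipschitzOn X V) (hreg : ∀ z ∈ X, ClarkeRegularAt V z)
    (hLU : ∀ z ∈ K, sSup ((fun a : ℝ => (a : EReal)) '' setLieDerivative F V z) ≤ (U z : EReal))
    {z : ℝ → EuclideanSpace ℝ (Fin d)} {C : NNReal} (hzK : ∀ t, z t ∈ K)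
    (hz : LipschitzWith C z) (hsol : ∀ t w, HasDerivAt z w t → w ∈ F (z t)) :
    DecaysAlong V U K z := by
  obtain ⟨C', hC'⟩ := (hV.mono hKX).exists_lipschitzOnWith_of_compact hK
  have hVz : LipschitzWith (C' * C) fun t => V (z t) := by
    rw [← lipschitzOnWith_univ] at hz ⊢
    exact hC'.comp hz fun t _ => hzK t
  refine ⟨hzK, hz.continuous, ⟨_, hVz⟩, ?_⟩
  filter_upwards [hz.ae_differentiableAt_real, hVz.ae_differentiableAt_real] with t h₁ h₂
  have hmem := mem_setLieDerivative hX hV (hKX (hzK t)) (hreg _ (hKX (hzK t))) h₁.hasDerivAt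
    h₂.hasDerivAt (hsol _ _ h₁.hasDerivAt)
  exact EReal.coe_le_coe_iff.1 ((le_sSup (mem_image_of_mem _ hmem)).trans (hLU _ (hzK t)))

namespace DecaysAlong

variable {V U : EuclideanSpace ℝ (Fin d) → ℝ} {K X : Set (EuclideanSpace ℝ (Fin d))}
  {z : ℝ → EuclideanSpace ℝ (Fin d)}

theorem antitone (h : DecaysAlong V U K z) (hU0 : ∀ z ∈ K, U z ≤ 0) :
    Antitone fun t => V (z t) := fun s t hst => by
  obtain ⟨C, hC⟩ := h.lipschitz
  have := hC.sub_le_of_ae_deriv_le hst (c := 0) <| by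
    filter_upwards [h.deriv_le] with r hr _ using hr.trans (hU0 _ (h.mem r))
  linarith

/-- Upper semicontinuity keeps `U` below a negative constant near `z 0`, so that `V ∘ z` passes
strictly through its value at time `0`. -/
theorem lt_of_neg (h : DecaysAlong V U K z) (hKX : K ⊆ X) (hU0 : ∀ z ∈ K, U z ≤ 0)
    (hUsc : UpperSemicontinuousOn U X) (h0 : U (z 0) < 0) {s : ℝ} (hs : 0 < s) :
    V (z 0) < V (z (-s)) := by
  obtain ⟨C, hC⟩ := h.lipschitz
  have hlt : U (z 0) < U (z 0) / 2 := by linarith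
  have hev : ∀ᶠ t in 𝓝 (0 : ℝ), U (z t) < U (z 0) / 2 := by
    have hz : Tendsto z (𝓝 0) (𝓝[X] (z 0)) := tendsto_nhdsWithin_iff.2
      ⟨h.continuous.tendsto 0, Eventually.of_forall fun t => hKX (h.mem t)⟩
    exact hz.eventually (hUsc _ (hKX (h.mem 0)) _ hlt)
  obtain ⟨δ, hδ, hδU⟩ := Metric.eventually_nhds_iff.1 hev
  set r := min s (δ / 2)
  have hr : 0 < r := lt_min hs (by linarith)
  have hrδ : r ≤ δ / 2 := min_le_right _ _
  have hdecay := hC.sub_le_of_ae_deriv_le (a := -r) (b := 0) (c := U (z 0) / 2) (by linarith) <| by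
    filter_upwards [h.deriv_le] with t ht htr
    refine ht.trans (hδU (y := t) ?_).le
    rw [Real.dist_eq, sub_zero, abs_lt]
    exact ⟨by linarith [htr.1], by linarith [htr.2]⟩
  have hmono : V (z (-r)) ≤ V (z (-s)) :=
    h.antitone hU0 (neg_le_neg (min_le_left s (δ / 2)))
  nlinarith

end DecaysAlong

/-! ### Limit points and upcrossings -/

theorem mem_limitPoints_of_tendsto {x : ℕ → EuclideanSpace ℝ (Fin d)} {f : Filter ℕ} [f.NeBot]
    {p : ℕ → ℕ} {a : EuclideanSpace ℝ (Fin d)} (hp : Tendsto p f atTop)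
    (h : Tendsto (fun n => x (p n)) f (𝓝 a)) : a ∈ limitPoints x :=
  MapClusterPt.of_comp hp (Tendsto.mapClusterPt h)

theorem isClosed_limitPoints (x : ℕ → EuclideanSpace ℝ (Fin d)) : IsClosed (limitPoints x) :=
  isClosed_setOfPred_clusterPt

theorem limitPoints_subset {x : ℕ → EuclideanSpace ℝ (Fin d)}
    {K : Set (EuclideanSpace ℝ (Fin d))} (hK : IsClosed K) (hxK : ∀ k, 1 ≤ k → x k ∈ K) :
    limitPoints x ⊆ K := fun p hp => by
  obtain ⟨g, hg, hgp⟩ := mapClusterPt_iff_ultrafilter.1 hp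
  exact hK.mem_of_tendsto hgp (hg ((eventually_ge_atTop 1).mono hxK))

theorem tendsto_comp_of_tendsto {V : EuclideanSpace ℝ (Fin d) → ℝ}
    {x : ℕ → EuclideanSpace ℝ (Fin d)} {K : Set (EuclideanSpace ℝ (Fin d))}
    (hV : ContinuousOn V K) (hxK : ∀ k, 1 ≤ k → x k ∈ K) {f : Filter ℕ} {p : ℕ → ℕ}
    {a : EuclideanSpace ℝ (Fin d)} (ha : a ∈ K) (hp : Tendsto p f atTop)
    (h : Tendsto (fun n => x (p n)) f (𝓝 a)) : Tendsto (fun n => V (x (p n))) f (𝓝 (V a)) :=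
  (hV a ha).tendsto.comp (tendsto_nhdsWithin_iff.2
    ⟨h, (hp.eventually_ge_atTop 1).mono fun _ hn => hxK _ hn⟩)

/-- A sequence that is infinitely often below `a` and infinitely often above `c ≥ a` has
infinitely many passages from below `a` to a first time at or above `c`. -/
theorem exists_upcrossings {φ : ℕ → ℝ} {a c : ℝ} (hac : a ≤ c) (ha : ∃ᶠ k in atTop, φ k < a)
    (hc : ∃ᶠ k in atTop, c < φ k) :
    ∃ k l : ℕ → ℕ, ∀ n, n ≤ k n ∧ k n < l n ∧ φ (k n) < a ∧
      (∀ j, k n ≤ j → j < l n → φ j < c) ∧ c ≤ φ (l n) := by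
  have h : ∀ n, ∃ k l : ℕ, n ≤ k ∧ k < l ∧ φ k < a ∧ (∀ j, k ≤ j → j < l → φ j < c) ∧
      c ≤ φ l := fun n => by
    classical
    obtain ⟨k, hnk, hk⟩ := frequently_atTop.1 ha n
    obtain ⟨i, hki, hi⟩ := frequently_atTop.1 hc k
    have hex : ∃ l, k ≤ l ∧ c ≤ φ l := ⟨i, hki, hi.le⟩
    obtain ⟨hkl, hl⟩ := Nat.find_spec hex
    refine ⟨k, Nat.find hex, hnk, lt_of_le_of_ne hkl fun h => ?_, hk, fun j hkj hj => ?_, hl⟩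
    · rw [← h] at hl
      linarith
    · by_contra! hcj
      exact Nat.find_min hex hj ⟨hkj, hcj⟩
  choose k l hkl using h
  exact ⟨k, l, hkl⟩

/-- Every base step gives rise, along an ultrafilter, to a limit trajectory along which `V` decays
at rate `U`. -/
def HasDecayingLimits (γ : ℕ → ℝ) (x : ℕ → EuclideanSpace ℝ (Fin d))
    (V U : EuclideanSpace ℝ (Fin d) → ℝ) (K : Set (EuclideanSpace ℝ (Fin d))) : Prop :=
  ∀ (f : Ultrafilter ℕ) (l : ℕ → ℕ), Tendsto l f atTop →
    ∃ z : ℝ → EuclideanSpace ℝ (Fin d), DecaysAlong V U K z ∧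
      ∀ t, Tendsto (fun n => x (timeIndex γ (elapsed γ (l n) + t))) f (𝓝 (z t))

section Levels

variable {γ : ℕ → ℝ} {x v : ℕ → EuclideanSpace ℝ (Fin d)} {V U : EuclideanSpace ℝ (Fin d) → ℝ}
  {X K : Set (EuclideanSpace ℝ (Fin d))} {M : ℝ}

/-- A level `c` strictly between two values of `V` on the limit set is attained at a limit point
where `U` vanishes, namely at the limit of the upper ends of upcrossings of `c`. If `U` were
negative there, then `V` would exceed `c` shortly before the end of the upcrossing, so the
upcrossings would take a vanishing time, which a Lipschitz limit trajectory does not allow. -/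
theorem exists_mem_limitPoints_eq_level (hγ : StepSizeAssumption γ) (hM : 0 ≤ M)
    (h : HasDrift γ x v M) (hlim : HasDecayingLimits γ x V U K) (hK : IsCompact K) (hKX : K ⊆ X)
    (hxK : ∀ k, 1 ≤ k → x k ∈ K) (hV : ContinuousOn V K) (hU0 : ∀ z ∈ K, U z ≤ 0)
    (hUsc : UpperSemicontinuousOn U X) {p q : EuclideanSpace ℝ (Fin d)} (hp : p ∈ limitPoints x)
    (hq : q ∈ limitPoints x) {c : ℝ} (hpc : V p < c) (hcq : c < V q) :
    ∃ r ∈ limitPoints x, V r = c ∧ U r = 0 := by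
  have hVtendsto : ∀ {a}, a ∈ limitPoints x → ∃ g : Ultrafilter ℕ, (g : Filter ℕ) ≤ atTop ∧
      Tendsto (fun k => V (x k)) g (𝓝 (V a)) := fun {a} ha => by
    obtain ⟨g, hg, hga⟩ := mapClusterPt_iff_ultrafilter.1 ha
    exact ⟨g, hg, tendsto_comp_of_tendsto hV hxK (limitPoints_subset hK.isClosed hxK ha)
      (p := fun k => k) hg hga⟩
  obtain ⟨g₁, hg₁, hp₁⟩ := hVtendsto hp
  obtain ⟨g₂, hg₂, hq₂⟩ := hVtendsto hq
  set a := (V p + c) / 2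
  have hpa : V p < a := by simp only [a]; linarith
  have hac : a < c := by simp only [a]; linarith
  obtain ⟨k, l, hkl⟩ := exists_upcrossings hac.le
    ((hp₁.eventually_lt_const hpa).frequently.filter_mono hg₁)
    ((hq₂.eventually_const_lt hcq).frequently.filter_mono hg₂)
  choose hnk hkl hka hlt hcl using hkl
  obtain ⟨f, hf⟩ : ∃ f : Ultrafilter ℕ, ↑f ≤ (atTop : Filter ℕ) := ⟨_, Ultrafilter.of_le atTop⟩
  have hk : Tendsto k f atTop := (tendsto_atTop_mono hnk tendsto_id).mono_left hf
  have hl : Tendsto l f atTop := tendsto_atTop_mono (fun n => (hkl n).le) hk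
  obtain ⟨b, hbK, hb⟩ := exists_tendsto_of_isCompact hK hxK f hk
  obtain ⟨z, hz, hzlim⟩ := hlim f l hl
  have hz0 : Tendsto (fun n => x (l n)) f (𝓝 (z 0)) := by
    simpa only [add_zero, hγ.timeIndex_elapsed] using hzlim 0
  have hVb : V b ≤ a := le_of_tendsto (tendsto_comp_of_tendsto hV hxK hbK hk hb)
    (Eventually.of_forall fun n => (hka n).le)
  have hVl := tendsto_comp_of_tendsto hV hxK (hz.mem 0) hl hz0
  -- The last step of an upcrossing is short, so its end lies at level `c` in the limit.
  have hVz : V (z 0) = c := by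
    refine le_antisymm ?_ (ge_of_tendsto hVl (Eventually.of_forall hcl))
    have hl1 : Tendsto (fun n => l n - 1) f atTop :=
      tendsto_atTop_mono (fun n => Nat.le_sub_one_of_lt (hkl n)) hk
    have hx1 : Tendsto (fun n => x (l n - 1)) f (𝓝 (z 0)) := by
      have := hz0.sub (h.tendsto_succ_sub hγ hl1)
      rw [sub_zero] at this
      refine this.congr fun n => ?_
      rw [Nat.sub_add_cancel (Nat.one_le_of_lt (hkl n)), sub_sub_cancel]
    refine le_of_tendsto (tendsto_comp_of_tendsto hV hxK (hz.mem 0) hl1 hx1)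
      (Eventually.of_forall fun n => ?_)
    have := hkl n
    exact (hlt n _ (by omega) (by omega)).le
  refine ⟨z 0, mem_limitPoints_of_tendsto hl hz0, hVz, ?_⟩
  by_contra hU
  have hUneg : U (z 0) < 0 := lt_of_le_of_ne (hU0 _ (hz.mem 0)) hU
  have hbound : ∀ s > 0, ‖z 0 - b‖ ≤ M * s := fun s hs => by
    have hVs := hz.lt_of_neg hKX hU0 hUsc hUneg hs
    obtain ⟨c', hc'₁, hc'₂⟩ := exists_between hVs
    set j : ℕ → ℕ := fun n => timeIndex γ (elapsed γ (l n) + -s)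
    have hVj := tendsto_comp_of_tendsto hV hxK (hz.mem (-s)) (hγ.tendsto_timeIndex_shift hl (-s))
      (hzlim (-s))
    have hjk : ∀ᶠ n in f, j n ≤ k n := by
      filter_upwards [hVj.eventually_const_lt hc'₂, hVl.eventually_lt_const hc'₁] with n h₁ h₂
      by_contra! hkj
      have hjl : j n ≤ l n := hγ.timeIndex_le.2 (by linarith)
      rcases hjl.lt_or_eq with hjl | hjl
      · have : V (x (j n)) < c := hlt n _ hkj.le hjl
        have : c' < V (x (j n)) := h₁
        linarith
      · have : c' < V (x (j n)) := h₁
        rw [hjl] at this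
        linarith
    have hT : Tendsto (fun n => elapsed γ (l n) - elapsed γ (j n)) f (𝓝 s) := by
      simpa using (hγ.tendsto_elapsed_shift hl (-s)).neg
    refine h.norm_sub_le_of_tendsto hM hγ hk (Eventually.of_forall fun n => (hkl n).le) ?_ hT hb hz0
    exact hjk.mono fun n hn => sub_le_sub_left (hγ.strictMono_elapsed.monotone hn) _
  have hzb : ‖z 0 - b‖ ≤ 0 := by
    have hs : Tendsto (fun s : ℝ => M * s) (𝓝[>] 0) (𝓝 0) := by
      simpa using ((continuous_const_mul M).tendsto 0).mono_left
        (nhdsWithin_le_nhds (s := Ioi (0 : ℝ)))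
    exact ge_of_tendsto hs (eventually_mem_nhdsWithin.mono hbound)
  rw [← sub_eq_zero.1 (norm_le_zero_iff.1 hzb)] at hVb
  linarith

/-- If `V` is constant on the limit set, then `U` vanishes there, since `V` would strictly
decrease along a limit trajectory through a point where `U` is negative. -/
theorem eq_zero_of_subsingleton (hγ : StepSizeAssumption γ)
    (hlim : HasDecayingLimits γ x V U K) (hKX : K ⊆ X) (hU0 : ∀ z ∈ K, U z ≤ 0)
    (hUsc : UpperSemicontinuousOn U X) (hsub : (V '' limitPoints x).Subsingleton)
    {p : EuclideanSpace ℝ (Fin d)} (hp : p ∈ limitPoints x) : U p = 0 := by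
  obtain ⟨g, hg, hgp⟩ := mapClusterPt_iff_ultrafilter.1 hp
  have hid : Tendsto (fun k : ℕ => k) g atTop := hg
  obtain ⟨z, hz, hzlim⟩ := hlim g _ hid
  have hzL : ∀ t, z t ∈ limitPoints x := fun t =>
    mem_limitPoints_of_tendsto (hγ.tendsto_timeIndex_shift hid t) (hzlim t)
  have hzp : z 0 = p := tendsto_nhds_unique
    (by simpa only [add_zero, hγ.timeIndex_elapsed] using hzlim 0) hgp
  by_contra hU
  rw [← hzp] at hU
  have hUneg := lt_of_le_of_ne (hU0 _ (hz.mem 0)) hU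
  exact (hz.lt_of_neg hKX hU0 hUsc hUneg one_pos).ne
    (hsub (mem_image_of_mem V (hzL 0)) (mem_image_of_mem V (hzL (-1))))

end Levels

theorem isCompact_zeros_inter {X K : Set (EuclideanSpace ℝ (Fin d))}
    {U : EuclideanSpace ℝ (Fin d) → ℝ} (hX : IsOpen X) (hK : IsCompact K) (hKX : K ⊆ X)
    (hU0 : ∀ z ∈ K, U z ≤ 0) (hUsc : UpperSemicontinuousOn U X) :
    IsCompact ({z ∈ X | U z = 0} ∩ K) := by
  refine hK.of_isClosed_subset (isClosed_of_closure_subset fun p hp => ?_) inter_subset_right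
  have hpK : p ∈ K := hK.isClosed.closure_subset_iff.2 inter_subset_right hp
  refine ⟨⟨hKX hpK, ?_⟩, hpK⟩
  by_contra hU
  have hev := hUsc p (hKX hpK) 0 (lt_of_le_of_ne (hU0 p hpK) hU)
  rw [hX.nhdsWithin_eq (hKX hpK)] at hev
  obtain ⟨q, hq, hqS⟩ := ((mem_closure_iff_frequently.1 hp).and_eventually hev).exists
  exact hqS.ne hq.1.2

end

/-! ### The limit set -/

theorem mainTheorem2 {d : ℕ}
    (X : Set (EuclideanSpace ℝ (Fin d)))
    (F : EuclideanSpace ℝ (Fin d) → Set (EuclideanSpace ℝ (Fin d)))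
    (x : ℕ → EuclideanSpace ℝ (Fin d)) (γ : ℕ → ℝ) (η y : ℕ → EuclideanSpace ℝ (Fin d))
    (hpad : IsPAD X F x γ η y)
    (hF : FieldAssumption X F)
    (hγ : StepSizeAssumption γ)
    (hη : NoiseAssumption γ η)
    (hy : ApproxAssumption X x y)
    (K : Set (EuclideanSpace ℝ (Fin d))) (hK : IsCompact K) (hKX : K ⊆ X)
    (hxK : ∀ k, 1 ≤ k → x k ∈ K)
    (V : EuclideanSpace ℝ (Fin d) → ℝ)
    (hVlip : LocallyLipschitzOn X V)
    (hVreg : ∀ z ∈ X, ClarkeRegularAt V z)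
    (U : EuclideanSpace ℝ (Fin d) → ℝ)
    (hUsc : UpperSemicontinuousOn U X)
    (hLU : ∀ z ∈ K, sSup ((fun a : ℝ => (a : EReal)) '' setLieDerivative F V z) ≤ (U z : EReal))
    (hU0 : ∀ z ∈ K, U z ≤ 0)
    (S : Set (EuclideanSpace ℝ (Fin d))) (hS : S = {z ∈ X | U z = 0}) :
    (∃ a b : ℝ, a ≤ b ∧ V '' limitPoints x = Icc a b ∧ Icc a b ⊆ V '' (S ∩ K)) ∧
      (interior (V '' (S ∩ K)) = ∅ → ConvergesToSet x (S ∩ K)) := by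
  obtain ⟨v, hvF, hxv⟩ : ∃ v : ℕ → EuclideanSpace ℝ (Fin d), (∀ k, 1 ≤ k → v k ∈ F (y k)) ∧
      ∀ k, x (k + 1) = x k + γ (k + 1) • (v (k + 1) + η (k + 1)) := by
    choose u huF hu using hpad.2
    refine ⟨fun k => u (k - 1), fun k hk => ?_, fun k => hu k⟩
    have := huF (k - 1)
    rwa [Nat.sub_add_cancel hk] at this
  obtain ⟨M, hM, hbound⟩ := hF.exists_bound hK hKX hxK hy hvF
  have hdrift := hasDrift_of_noise hγ hη hxv hbound
  have hlim : HasDecayingLimits γ x V U K := fun f l hl => by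
    obtain ⟨z, ⟨C, hC⟩, hzlim, hzK, hsol⟩ :=
      exists_trajectory hM hF hγ hy hK hKX hxK hvF hdrift f hl
    exact ⟨z, decaysAlong_of_solution hF.isOpen hK hKX hVlip hVreg hLU hzK hC hsol, hzlim⟩
  have hVK : ContinuousOn V K := (hVlip.mono hKX).continuousOn
  set L := limitPoints x
  have hLK : L ⊆ K := limitPoints_subset hK.isClosed hxK
  have hlevel : ∀ {p q}, p ∈ L → q ∈ L → ∀ {c}, V p < c → c < V q →
      ∃ r ∈ L, V r = c ∧ U r = 0 := fun hp hq _ hpc hcq =>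
    exists_mem_limitPoints_eq_level hγ hM hdrift hlim hK hKX hxK hVK hU0 hUsc hp hq hpc hcq
  have hLne : L.Nonempty := by
    obtain ⟨a, -, ha⟩ := exists_tendsto_of_isCompact hK hxK (Ultrafilter.of atTop)
      (p := fun k => k) (Ultrafilter.of_le atTop)
    exact ⟨a, mem_limitPoints_of_tendsto (p := fun k => k) (Ultrafilter.of_le atTop) ha⟩
  have hLcomp : IsCompact L := hK.of_isClosed_subset (isClosed_limitPoints x) hLK
  have hVLcomp : IsCompact (V '' L) := hLcomp.image_of_continuousOn (hVK.mono hLK)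
  have hVLconn : IsConnected (V '' L) := by
    refine ⟨hLne.image V, OrdConnected.isPreconnected ⟨?_⟩⟩
    rintro _ ⟨p, hp, rfl⟩ _ ⟨q, hq, rfl⟩ c ⟨hpc, hcq⟩
    rcases hpc.eq_or_lt with rfl | hpc
    · exact ⟨p, hp, rfl⟩
    rcases hcq.eq_or_lt with rfl | hcq
    · exact ⟨q, hq, rfl⟩
    obtain ⟨r, hr, hrc, -⟩ := hlevel hp hq hpc hcq
    exact ⟨r, hr, hrc⟩
  have hIcc := eq_Icc_of_connected_compact hVLconn hVLcomp
  set a := sInf (V '' L)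
  set b := sSup (V '' L)
  have hab : a ≤ b := nonempty_Icc.1 (hIcc ▸ hLne.image V)
  have hcompS : IsCompact (S ∩ K) := hS ▸ isCompact_zeros_inter hF.isOpen hK hKX hU0 hUsc
  have hmemS : ∀ {r}, r ∈ L → U r = 0 → r ∈ S ∩ K := fun hr hUr =>
    ⟨hS ▸ ⟨hKX (hLK hr), hUr⟩, hLK hr⟩
  have hsingle : a = b → L ⊆ S ∩ K := fun hab' p hp => hmemS hp <|
    eq_zero_of_subsingleton hγ hlim hKX hU0 hUsc
      (by change (V '' L).Subsingleton; rw [hIcc, hab', Icc_self]; exact subsingleton_singleton) hp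
  have hIccS : Icc a b ⊆ V '' (S ∩ K) := by
    rcases hab.eq_or_lt with hab' | hab'
    · rw [← hIcc]
      exact image_mono (hsingle hab')
    -- The open interval is covered by upcrossing levels, and the image of `S ∩ K` is closed.
    · rw [← closure_Ioo hab'.ne]
      have hVS : IsClosed (V '' (S ∩ K)) :=
        (hcompS.image_of_continuousOn (hVK.mono inter_subset_right)).isClosed
      refine hVS.closure_subset_iff.2 fun c hc => ?_
      obtain ⟨p, hp, hpa⟩ : a ∈ V '' L := hIcc ▸ left_mem_Icc.2 hab
      obtain ⟨q, hq, hqb⟩ : b ∈ V '' L := hIcc ▸ right_mem_Icc.2 hab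
      obtain ⟨r, hr, hrc, hUr⟩ := hlevel hp hq (hpa ▸ hc.1) (hqb ▸ hc.2)
      exact ⟨r, hmemS hr hUr, hrc⟩
  refine ⟨⟨a, b, hab, hIcc, hIccS⟩, fun hint => ?_⟩
  have hab' : a = b := by
    by_contra hne
    have hsub : Ioo a b ⊆ interior (V '' (S ∩ K)) :=
      interior_maximal (Ioo_subset_Icc_self.trans hIccS) isOpen_Ioo
    rw [hint] at hsub
    exact (nonempty_Ioo.2 (lt_of_le_of_ne hab hne)).not_subset_empty hsub
  have hLS := hsingle hab'
  refine ⟨hLne.mono hLS, (tendsto_iff_ultrafilter _ _ _).2 fun g hg => ?_⟩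
  obtain ⟨p, -, hp⟩ := exists_tendsto_of_isCompact hK hxK g (p := fun k => k) hg
  have hpS := hLS (mem_limitPoints_of_tendsto (p := fun k => k) hg hp)
  have := ((Metric.continuous_infDist_pt (S ∩ K)).tendsto p).comp hp
  rwa [Metric.infDist_zero_of_mem hpS] at this
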